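/- Let $\Gamma$ be a finite connected 3-valent graph (loops and multiple edges allowed) with vertex set $V$ and edge set $E$, with a chosen orientation of its edges. Let $\mathcal A=\mathrm{SU}(2)^{E}$ be the space of $\mathrm{SU}(2)$-connections on $\Gamma$, on which the gauge group $\mathcal G=\mathrm{SU}(2)^{V}$ acts by $(g\cdot x)_e=g_{s(e)}\,x_e\,g_{t(e)}^{-1}$, where $s(e)$ and $t(e)$ are the source and the target of $e$, and let $uS=\mathcal A/\mathcal G$ be the unitary Schottky space. A spin network on $\Gamma$ is a map $j\colon E\to\frac12\mathbb Z_{\ge 0}=\widehat{\mathrm{SU}(2)}$ such that at every vertex the spins $j_1,j_2,j_3$ of the three half-edges there satisfy $j_1+j_2+j_3\in\mathbb Z$ and $|j_1-j_2|\le j_3\le j_1+j_2$. For a spin network $j$ choose at every vertex $v$ an intertwiner, that is a nonzero $\mathrm{SU}(2)$-invariant vector $i_v\in j_{v,1}\otimes j_{v,2}\otimes j_{v,3}$ (it is unique up to a scalar), and let $B(\Gamma_j)\in\operatorname{End}\bigl(\bigotimes_{e}j_e\bigr)$ be the endomorphism that corresponds to $\bigotimes_v i_v$ under $\bigotimes_v(j_{v,1}\otimes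 j_{v,2}\otimes j_{v,3})\cong\bigl(\bigotimes_e j_e\bigr)\otimes\bigl(\bigotimes_e j_e\bigr)\cong\bigl(\bigotimes_e j_e\bigr)\otimes\bigl(\bigotimes_e j_e\bigr)^*$, where the first isomorphism puts the half-edges at the targets into the first factor and those at the sources into the second, and the last one is given by the $\mathrm{SU}(2)$-invariant bilinear forms on the $j_e$. The function $x\mapsto \operatorname{Tr}\bigl[B(\Gamma_j)\bigotimes_e j_e(x_e)\bigr]$ on $\mathcal A$ is gauge invariant and defines a function $f_{\Gamma_j}$ on $uS$. Then $\Gamma$ and the function $f_{\Gamma_j}$ determine the spin network uniquely: if $j$ and $j'$ are spin networks on $\Gamma$ and $f_{\Gamma_j}=f_{\Gamma_{j'}}$ on $uS$ (for some choice of the intertwiners of $j$ and of $j'$), then $j=j'$. -/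

import Mathlib

/-- The group `SU(2)`. -/
abbrev SU2 : Type := ↥(Matrix.specialUnitaryGroup (Fin 2) ℂ)

/-! ### The irreducible representations of `SU(2)` -/

namespace SU2

/-- The matrix, in the basis `X^k Y^(n-k)` (`0 ≤ k ≤ n`), of the substitution
`X ↦ a X + c Y`, `Y ↦ b X + d Y` on binary forms of degree `n`, for `g = !![a, b; c, d]`.
(The variable `Y` is set to `1`.) This is the `n`-th symmetric power of `ℂ²`. -/
noncomputable def symMatrix (n : ℕ) (g : Matrix (Fin 2) (Fin 2) ℂ) :
    Matrix (Fin (n + 1)) (Fin (n + 1)) ℂ :=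
  Matrix.of fun k l =>
    ((Polynomial.C (g 0 0) * Polynomial.X + Polynomial.C (g 1 0)) ^ (l : ℕ) *
      (Polynomial.C (g 0 1) * Polynomial.X + Polynomial.C (g 1 1)) ^ (n - (l : ℕ))).coeff k

/-- The invariant bilinear form on binary forms of degree `n`, in the basis `X^k Y^(n-k)`. It is
nondegenerate and identifies the representation of spin `n / 2` with its dual. -/
noncomputable def invForm (n : ℕ) : Matrix (Fin (n + 1)) (Fin (n + 1)) ℂ :=
  Matrix.of fun k l =>
    if (k : ℕ) + (l : ℕ) = n then (-1 : ℂ) ^ (k : ℕ) / (n.choose k : ℂ) else 0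

/-- The row of all monomials of degree `n` in `x, y`. -/
def monoms (n : ℕ) (x y : ℂ) : Fin (n + 1) → ℂ := fun k => x ^ (k : ℕ) * y ^ (n - (k : ℕ))

/-- The coordinates of `(x X + y Y)^n`. -/
def powVec (n : ℕ) (x y : ℂ) : Fin (n + 1) → ℂ :=
  fun k => (n.choose k : ℂ) * (x ^ (k : ℕ) * y ^ (n - (k : ℕ)))

open Matrix in
theorem monoms_vecMul_symMatrix (n : ℕ) (g : Matrix (Fin 2) (Fin 2) ℂ) (x y : ℂ) :
    monoms n x y ᵥ* symMatrix n g =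
      monoms n (x * g 0 0 + y * g 1 0) (x * g 0 1 + y * g 1 1) := by
  have key : ∀ y : ℂ, y ≠ 0 → monoms n x y ᵥ* symMatrix n g =
      monoms n (x * g 0 0 + y * g 1 0) (x * g 0 1 + y * g 1 1) := by
    intro y hy
    ext l
    have hl : (l : ℕ) ≤ n := Nat.lt_succ_iff.mp l.2
    set p : Polynomial ℂ :=
      (Polynomial.C (g 0 0) * Polynomial.X + Polynomial.C (g 1 0)) ^ (l : ℕ) *
      (Polynomial.C (g 0 1) * Polynomial.X + Polynomial.C (g 1 1)) ^ (n - (l : ℕ)) with hp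
    have hdeg : p.natDegree < n + 1 := by
      have h1 : ∀ a b : ℂ, (Polynomial.C a * Polynomial.X + Polynomial.C b).natDegree ≤ 1 :=
        fun a b => Polynomial.natDegree_linear_le
      have h2 := Polynomial.natDegree_pow_le_of_le (l : ℕ) (h1 (g 0 0) (g 1 0))
      have h3 := Polynomial.natDegree_pow_le_of_le (n - (l : ℕ)) (h1 (g 0 1) (g 1 1))
      have h4 := Polynomial.natDegree_mul_le_of_le h2 h3
      rw [← hp] at h4
      omega
    have hev := Polynomial.eval_eq_sum_range' hdeg (x / y)
    have hsum : (monoms n x y ᵥ* symMatrix n g) l = y ^ n * p.eval (x / y) := by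
      rw [hev, Finset.mul_sum,
        ← Fin.sum_univ_eq_sum_range (fun i => y ^ n * (p.coeff i * (x / y) ^ i)) (n + 1)]
      simp only [vecMul, dotProduct, symMatrix, monoms, of_apply, ← hp]
      refine Finset.sum_congr rfl fun k _ => ?_
      have hk : (k : ℕ) ≤ n := Nat.lt_succ_iff.mp k.2
      have : y ^ n = y ^ (k : ℕ) * y ^ (n - (k : ℕ)) := by rw [← pow_add]; congr 1; omega
      rw [this, div_pow]
      field_simp
    rw [hsum, hp]
    have : y ^ n = y ^ (l : ℕ) * y ^ (n - (l : ℕ)) := by rw [← pow_add]; congr 1; omega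
    simp only [Polynomial.eval_mul, Polynomial.eval_pow, Polynomial.eval_add, Polynomial.eval_C,
      Polynomial.eval_X, monoms]
    rw [this, mul_mul_mul_comm, ← mul_pow, ← mul_pow]
    congr 2 <;> (field_simp)
  have hd : Dense {y : ℂ | y ≠ 0} := dense_compl_singleton (0 : ℂ)
  have hc1 : Continuous fun y : ℂ => monoms n x y ᵥ* symMatrix n g := by
    refine continuous_pi fun l => ?_
    simp only [vecMul, dotProduct, monoms]
    fun_prop
  have hc2 : Continuous fun y : ℂ =>
      monoms n (x * g 0 0 + y * g 1 0) (x * g 0 1 + y * g 1 1) := by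
    refine continuous_pi fun l => ?_
    simp only [monoms]
    fun_prop
  exact congrFun (Continuous.ext_on hd hc1 hc2 fun y hy => key y hy) y

open Matrix in
theorem monoms_separate (n : ℕ) {u v : Fin (n + 1) → ℂ}
    (h : ∀ x y : ℂ, monoms n x y ⬝ᵥ u = monoms n x y ⬝ᵥ v) : u = v := by
  have hinj : Function.Injective fun i : Fin (n + 1) => ((i : ℕ) : ℂ) := by
    intro a b hab
    exact Fin.ext (Nat.cast_injective hab)
  have := Matrix.eq_zero_of_forall_index_sum_pow_mul_eq_zero (v := u - v) hinj (by
    intro i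
    have h1 := h ((i : ℕ) : ℂ) 1
    simp only [dotProduct, monoms, one_pow, mul_one] at h1
    simp only [Pi.sub_apply, mul_sub, Finset.sum_sub_distrib, h1, sub_self])
  exact sub_eq_zero.mp this

open Matrix in
theorem symMatrix_mul (n : ℕ) (g h : Matrix (Fin 2) (Fin 2) ℂ) :
    symMatrix n (g * h) = symMatrix n g * symMatrix n h := by
  ext k l
  have : (fun k => symMatrix n (g * h) k l) = fun k => (symMatrix n g * symMatrix n h) k l := by
    refine monoms_separate n fun x y => ?_
    change (monoms n x y ᵥ* symMatrix n (g * h)) l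
      = (monoms n x y ᵥ* (symMatrix n g * symMatrix n h)) l
    rw [← vecMul_vecMul]
    simp only [monoms_vecMul_symMatrix]
    have e1 : x * (g * h) 0 0 + y * (g * h) 1 0 =
        (x * g 0 0 + y * g 1 0) * h 0 0 + (x * g 0 1 + y * g 1 1) * h 1 0 := by
      simp only [mul_apply, Fin.sum_univ_two]
      ring
    have e2 : x * (g * h) 0 1 + y * (g * h) 1 1 =
        (x * g 0 0 + y * g 1 0) * h 0 1 + (x * g 0 1 + y * g 1 1) * h 1 1 := by
      simp only [mul_apply, Fin.sum_univ_two]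
      ring
    rw [e1, e2]
  exact congrFun this k

open Matrix in
theorem symMatrix_one (n : ℕ) : symMatrix n 1 = 1 := by
  ext k l
  have : (fun k => symMatrix n 1 k l) = fun k => (1 : Matrix (Fin (n + 1)) (Fin (n + 1)) ℂ) k l := by
    refine monoms_separate n fun x y => ?_
    change (monoms n x y ᵥ* symMatrix n 1) l = (monoms n x y ᵥ* 1) l
    rw [monoms_vecMul_symMatrix, vecMul_one]
    simp
  exact congrFun this k

open Matrix in
theorem monoms_dotProduct_powVec (n : ℕ) (x y s t : ℂ) :
    monoms n x y ⬝ᵥ powVec n s t = (x * s + y * t) ^ n := by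
  rw [add_pow, ← Fin.sum_univ_eq_sum_range
    (fun m => (x * s) ^ m * (y * t) ^ (n - m) * (n.choose m : ℂ)) (n + 1)]
  simp only [dotProduct, monoms, powVec, mul_pow]
  exact Finset.sum_congr rfl fun k _ => by ring

open Matrix in
theorem symMatrix_mulVec_powVec (n : ℕ) (g : Matrix (Fin 2) (Fin 2) ℂ) (s t : ℂ) :
    symMatrix n g *ᵥ powVec n s t =
      powVec n (g 0 0 * s + g 0 1 * t) (g 1 0 * s + g 1 1 * t) := by
  refine monoms_separate n fun x y => ?_
  rw [dotProduct_mulVec, monoms_vecMul_symMatrix, monoms_dotProduct_powVec,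
    monoms_dotProduct_powVec]
  congr 1
  ring

open Matrix in
theorem powVec_invForm_powVec (n : ℕ) (s t s' t' : ℂ) :
    powVec n s t ⬝ᵥ (invForm n *ᵥ powVec n s' t') = (t * s' - s * t') ^ n := by
  have h1 : invForm n *ᵥ powVec n s' t' =
      fun k : Fin (n + 1) => (-1 : ℂ) ^ (k : ℕ) * (s' ^ (n - (k : ℕ)) * t' ^ (k : ℕ)) := by
    ext k
    have hk : (k : ℕ) ≤ n := Nat.lt_succ_iff.mp k.2
    simp only [mulVec, dotProduct, invForm, of_apply, powVec]
    rw [Finset.sum_eq_single (⟨n - k, by omega⟩ : Fin (n + 1))]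
    · have hne : (n.choose k : ℂ) ≠ 0 := by
        exact_mod_cast (Nat.choose_pos hk).ne'
      have e1 : (k : ℕ) + (n - k) = n := by omega
      have e2 : n - (n - (k : ℕ)) = k := by omega
      simp only [e1, e2, if_true, Nat.choose_symm hk]
      field_simp
    · intro l _ hl
      rw [if_neg, zero_mul]
      intro hkl
      exact hl (Fin.ext (by simp only; omega))
    · simp
  rw [h1, show t * s' - s * t' = -(s * t') + t * s' by ring, add_pow, ← Fin.sum_univ_eq_sum_range
    (fun m => (-(s * t')) ^ m * (t * s') ^ (n - m) * (n.choose m : ℂ)) (n + 1)]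
  simp only [dotProduct, powVec]
  refine Finset.sum_congr rfl fun k _ => ?_
  rw [neg_pow (s * t'), mul_pow, mul_pow]
  ring

open Matrix in
theorem powVec_separate (n : ℕ) {u v : Fin (n + 1) → ℂ}
    (h : ∀ x y : ℂ, powVec n x y ⬝ᵥ u = powVec n x y ⬝ᵥ v) : u = v := by
  have := monoms_separate n (u := fun k => (n.choose k : ℂ) * u k)
    (v := fun k => (n.choose k : ℂ) * v k) (by
      intro x y
      have := h x y
      simp only [dotProduct, powVec, monoms] at this ⊢
      convert this using 2 <;> ring)
  ext k
  have hk : (k : ℕ) ≤ n := Nat.lt_succ_iff.mp k.2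
  have hne : (n.choose k : ℂ) ≠ 0 := by exact_mod_cast (Nat.choose_pos hk).ne'
  exact mul_left_cancel₀ hne (congrFun this k)

open Matrix in
theorem symMatrix_invForm (n : ℕ) (g : Matrix (Fin 2) (Fin 2) ℂ) (hg : g.det = 1) :
    (symMatrix n g)ᵀ * invForm n * symMatrix n g = invForm n := by
  have hv : ∀ s' t', ((symMatrix n g)ᵀ * invForm n * symMatrix n g) *ᵥ powVec n s' t' =
      invForm n *ᵥ powVec n s' t' := by
    intro s' t'
    refine powVec_separate n fun s t => ?_
    rw [← mulVec_mulVec, ← mulVec_mulVec, dotProduct_mulVec, vecMul_transpose,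
      symMatrix_mulVec_powVec, symMatrix_mulVec_powVec, powVec_invForm_powVec,
      powVec_invForm_powVec]
    rw [det_fin_two] at hg
    congr 1
    linear_combination (t * s' - s * t') * hg
  ext k l
  have : (fun l => ((symMatrix n g)ᵀ * invForm n * symMatrix n g) k l) =
      fun l => invForm n k l := by
    refine powVec_separate n fun s t => ?_
    rw [dotProduct_comm, dotProduct_comm (powVec n s t)]
    exact congrFun (hv s t) k
  exact congrFun this l

/-- The irreducible representation of `SU(2)` of spin `n / 2`, on the space `ℂ^(n+1)` of binary
forms of degree `n`. -/
noncomputable def spinRep (n : ℕ) : SU2 →* Matrix (Fin (n + 1)) (Fin (n + 1)) ℂ where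
  toFun g := symMatrix n (g : Matrix (Fin 2) (Fin 2) ℂ)
  map_one' := symMatrix_one n
  map_mul' g h := symMatrix_mul n g h

end SU2

/-! ### Tensor products, in coordinates -/

/-- The tensor product `⨂ i, M i` of square matrices, as a matrix on `⨂ i, ℂ^(n i + 1)`, the basis of
which is indexed by multi-indices. -/
def tensorMatrix {ι : Type*} [Fintype ι] {n : ι → ℕ}
    (M : ∀ i, Matrix (Fin (n i + 1)) (Fin (n i + 1)) ℂ) :
    Matrix (∀ i, Fin (n i + 1)) (∀ i, Fin (n i + 1)) ℂ :=
  Matrix.of fun p q => ∏ i, M i (p i) (q i)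

theorem tensorMatrix_mul {ι : Type*} [Fintype ι] [DecidableEq ι] {n : ι → ℕ}
    (M N : ∀ i, Matrix (Fin (n i + 1)) (Fin (n i + 1)) ℂ) :
    tensorMatrix M * tensorMatrix N = tensorMatrix fun i => M i * N i := by
  ext p q
  simp only [tensorMatrix, Matrix.mul_apply, Matrix.of_apply, ← Finset.prod_mul_distrib,
    Fintype.prod_sum]

theorem tensorMatrix_one {ι : Type*} [Fintype ι] [DecidableEq ι] {n : ι → ℕ} :
    tensorMatrix (fun i => (1 : Matrix (Fin (n i + 1)) (Fin (n i + 1)) ℂ)) = 1 := by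
  ext p q
  simp only [tensorMatrix, Matrix.of_apply, Matrix.one_apply]
  rw [Finset.prod_ite_zero]
  simp [funext_iff]

theorem tensorMatrix_transpose {ι : Type*} [Fintype ι] {n : ι → ℕ}
    (M : ∀ i, Matrix (Fin (n i + 1)) (Fin (n i + 1)) ℂ) :
    (tensorMatrix M).transpose = tensorMatrix fun i => (M i).transpose := rfl

/-! ### 3-valent graphs and gauge theory on them -/

/-- A connected 3-valent graph with vertices `V` and edges `E` (loops and multiple edges are
allowed), with an orientation of every edge. A pair `(e, true)` is the half-edge of `e` at its
target, `(e, false)` the half-edge at its source; a loop has two half-edges at its vertex. -/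
structure TrivalentGraph (V E : Type*) where
  /-- the source of an edge -/
  src : E → V
  /-- the target of an edge -/
  tgt : E → V
  trivalent : ∀ v : V, Nat.card {h : E × Bool // (if h.2 then tgt h.1 else src h.1) = v} = 3
  nonempty : Nonempty V
  connected : ∀ u v : V, Relation.EqvGen (fun a b => ∃ e, src e = a ∧ tgt e = b) u v

namespace TrivalentGraph

variable {V E : Type*}

/-- The vertex of a half-edge. -/
def vertex (Γ : TrivalentGraph V E) (h : E × Bool) : V := if h.2 then Γ.tgt h.1 else Γ.src h.1

/-- The star of a vertex: the three half-edges at it. -/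
abbrev Star (Γ : TrivalentGraph V E) (v : V) : Type _ := {h : E × Bool // Γ.vertex h = v}

/-- The space `SU(2)^E` of `SU(2)`-connections on the graph. -/
def Connection (_Γ : TrivalentGraph V E) : Type _ := E → SU2

/-- The gauge group `SU(2)^V` acts on connections by `a(e) ↦ g(source e) a(e) g(target e)⁻¹`. -/
instance (Γ : TrivalentGraph V E) : MulAction (V → SU2) Γ.Connection where
  smul g a := fun e => g (Γ.src e) * a e * (g (Γ.tgt e))⁻¹
  one_smul a := by
    funext e
    change (1 : SU2) * a e * (1 : SU2)⁻¹ = a e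
    simp
  mul_smul g h a := by
    funext e
    change g (Γ.src e) * h (Γ.src e) * a e * (g (Γ.tgt e) * h (Γ.tgt e))⁻¹ =
      g (Γ.src e) * (h (Γ.src e) * a e * (h (Γ.tgt e))⁻¹) * (g (Γ.tgt e))⁻¹
    simp only [mul_inv_rev, mul_assoc]

/-- The unitary Schottky space: the space of gauge classes of connections on the graph. -/
def UnitarySchottky (Γ : TrivalentGraph V E) : Type _ :=
  MulAction.orbitRel.Quotient (V → SU2) Γ.Connection

end TrivalentGraph

/-! ### Spin networks and their functions -/

/-- The Clebsch-Gordan conditions on the spins `a / 2`, `b / 2`, `c / 2`: their sum is an integer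
and they satisfy the triangle inequalities. -/
def ClebschGordan (a b c : ℕ) : Prop := Even (a + b + c) ∧ c ≤ a + b ∧ a ≤ b + c ∧ b ≤ a + c

/-- An `SU(2)`-spin network on `Γ`: a labelling `j` of the edges by irreducible representations
of `SU(2)`, that is by spins `j e = twoSpin e / 2`, which satisfies the Clebsch-Gordan conditions
at every vertex. -/
structure SpinNetwork {V E : Type*} (Γ : TrivalentGraph V E) where
  /-- twice the spin of an edge -/
  twoSpin : E → ℕ
  clebschGordan : ∀ (v : V) (h₁ h₂ h₃ : Γ.Star v), h₁ ≠ h₂ → h₂ ≠ h₃ → h₁ ≠ h₃ →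
    ClebschGordan (twoSpin h₁.1.1) (twoSpin h₂.1.1) (twoSpin h₃.1.1)

namespace SpinNetwork

variable {V E : Type*} [Fintype V] [DecidableEq V] [Fintype E] [DecidableEq E]
  {Γ : TrivalentGraph V E}

/-- A choice of an intertwiner at every vertex `v`: a nonzero `SU(2)`-invariant vector in the
tensor product of the three representations on the half-edges at `v`. -/
structure Intertwiners (j : SpinNetwork Γ) where
  /-- the intertwiner at `v`, in coordinates -/
  vec : ∀ v : V, (∀ h : Γ.Star v, Fin (j.twoSpin h.1.1 + 1)) → ℂ
  ne_zero : ∀ v, vec v ≠ 0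
  invariant : ∀ (v : V) (g : SU2),
    (tensorMatrix fun h : Γ.Star v => SU2.spinRep (j.twoSpin h.1.1) g).mulVec (vec v) = vec v

/-- The representation `⨂ e, j e` of `SU(2)^E`. -/
noncomputable def rep (j : SpinNetwork Γ) (x : Γ.Connection) :
    Matrix (∀ e, Fin (j.twoSpin e + 1)) (∀ e, Fin (j.twoSpin e + 1)) ℂ :=
  tensorMatrix fun e => SU2.spinRep (j.twoSpin e) (x e)

/-- The tensor product over all vertices of the intertwiners, as an element of
`(⨂ e, j e) ⊗ (⨂ e, j e)`: the first factor collects the half-edges at the targets of the edges,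
the second one the half-edges at their sources. -/
def Intertwiners.tensor {j : SpinNetwork Γ} (i : j.Intertwiners) :
    Matrix (∀ e, Fin (j.twoSpin e + 1)) (∀ e, Fin (j.twoSpin e + 1)) ℂ :=
  Matrix.of fun p q => ∏ v, i.vec v fun h => if h.1.2 then p h.1.1 else q h.1.1

/-- The endomorphism `B` of `⨂ e, j e` that corresponds to the tensor product of the intertwiners
under the isomorphism `j e ≅ (j e)^*` (given by the invariant bilinear form) in the second
factor. -/
noncomputable def Intertwiners.endo {j : SpinNetwork Γ} (i : j.Intertwiners) :
    Matrix (∀ e, Fin (j.twoSpin e + 1)) (∀ e, Fin (j.twoSpin e + 1)) ℂ :=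
  i.tensor * tensorMatrix fun e => SU2.invForm (j.twoSpin e)

/-- The function `x ↦ Tr (B (⨂ e, j e) (x))` on `SU(2)^E`. -/
noncomputable def Intertwiners.connFun {j : SpinNetwork Γ} (i : j.Intertwiners)
    (x : Γ.Connection) : ℂ :=
  (i.endo * j.rep x).trace

theorem Intertwiners.tensor_invariant {j : SpinNetwork Γ} (i : j.Intertwiners) (g : V → SU2) :
    (tensorMatrix fun e => SU2.spinRep (j.twoSpin e) (g (Γ.tgt e))) * i.tensor *
      (tensorMatrix fun e => SU2.spinRep (j.twoSpin e) (g (Γ.src e))).transpose = i.tensor := by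
  ext p q
  symm
  have hflag : ∀ (p q p' q' : ∀ e, Fin (j.twoSpin e + 1)),
      (∏ v, ∏ h : Γ.Star v, SU2.spinRep (j.twoSpin h.1.1) (g v)
        (if h.1.2 then p h.1.1 else q h.1.1) (if h.1.2 then p' h.1.1 else q' h.1.1)) =
      (∏ e, SU2.spinRep (j.twoSpin e) (g (Γ.tgt e)) (p e) (p' e)) *
        ∏ e, SU2.spinRep (j.twoSpin e) (g (Γ.src e)) (q e) (q' e) := by
    intro p q p' q'
    let F : E × Bool → ℂ := fun f => SU2.spinRep (j.twoSpin f.1) (g (Γ.vertex f))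
        (if f.2 then p f.1 else q f.1) (if f.2 then p' f.1 else q' f.1)
    have h1 : ∀ v, (∏ h : Γ.Star v, SU2.spinRep (j.twoSpin h.1.1) (g v)
        (if h.1.2 then p h.1.1 else q h.1.1) (if h.1.2 then p' h.1.1 else q' h.1.1)) =
        ∏ h : Γ.Star v, F h.1 := by
      intro v
      refine Finset.prod_congr rfl fun h _ => ?_
      obtain ⟨f, rfl⟩ := h
      rfl
    refine (Finset.prod_congr rfl fun v _ => h1 v).trans ?_
    refine (Fintype.prod_fiberwise Γ.vertex F).trans ?_
    rw [Fintype.prod_prod_type, ← Finset.prod_mul_distrib]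
    refine Finset.prod_congr rfl fun e _ => ?_
    rw [Fintype.prod_bool]
    rfl
  have hinv : ∀ v, i.vec v (fun h => if h.1.2 then p h.1.1 else q h.1.1) =
      ∑ r, (∏ h : Γ.Star v, SU2.spinRep (j.twoSpin h.1.1) (g v)
        (if h.1.2 then p h.1.1 else q h.1.1) (r h)) * i.vec v r := fun v =>
    (congrFun (i.invariant v (g v)) (fun h => if h.1.2 then p h.1.1 else q h.1.1)).symm
  let φ : (∀ e, Fin (j.twoSpin e + 1)) × (∀ e, Fin (j.twoSpin e + 1)) →
      ∀ v, ∀ h : Γ.Star v, Fin (j.twoSpin h.1.1 + 1) :=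
    fun pq _ h => if h.1.2 then pq.1 h.1.1 else pq.2 h.1.1
  have hφ : Function.Bijective φ := by
    constructor
    · rintro ⟨p₁, q₁⟩ ⟨p₂, q₂⟩ h
      refine Prod.ext (funext fun e => ?_) (funext fun e => ?_)
      · exact congrFun (congrFun h (Γ.tgt e)) ⟨(e, true), rfl⟩
      · exact congrFun (congrFun h (Γ.src e)) ⟨(e, false), rfl⟩
    · intro r
      refine ⟨⟨fun e => r (Γ.tgt e) ⟨(e, true), rfl⟩, fun e => r (Γ.src e) ⟨(e, false), rfl⟩⟩, ?_⟩
      funext v h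
      obtain ⟨⟨e, b⟩, hv⟩ := h
      subst hv
      cases b <;> rfl
  calc i.tensor p q
      = ∏ v, ∑ r, (∏ h : Γ.Star v, SU2.spinRep (j.twoSpin h.1.1) (g v)
        (if h.1.2 then p h.1.1 else q h.1.1) (r h)) * i.vec v r := by
        simp only [tensor, Matrix.of_apply]
        exact Finset.prod_congr rfl fun v _ => hinv v
    _ = ∑ r : ∀ v, ∀ h : Γ.Star v, Fin (j.twoSpin h.1.1 + 1),
        ∏ v, ((∏ h : Γ.Star v, SU2.spinRep (j.twoSpin h.1.1) (g v)
        (if h.1.2 then p h.1.1 else q h.1.1) (r v h)) * i.vec v (r v)) :=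
        Fintype.prod_sum _
    _ = ∑ pq : (∀ e, Fin (j.twoSpin e + 1)) × (∀ e, Fin (j.twoSpin e + 1)),
        ∏ v, ((∏ h : Γ.Star v, SU2.spinRep (j.twoSpin h.1.1) (g v)
        (if h.1.2 then p h.1.1 else q h.1.1) (φ pq v h)) * i.vec v (φ pq v)) :=
        (hφ.sum_comp (fun r : ∀ v, ∀ h : Γ.Star v, Fin (j.twoSpin h.1.1 + 1) =>
          ∏ v, ((∏ h : Γ.Star v, SU2.spinRep (j.twoSpin h.1.1) (g v)
          (if h.1.2 then p h.1.1 else q h.1.1) (r v h)) * i.vec v (r v)))).symm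
    _ = _ := by
        rw [Fintype.sum_prod_type_right]
        simp only [Matrix.mul_apply, Matrix.transpose_apply, Finset.sum_mul]
        refine Finset.sum_congr rfl fun q' _ => Finset.sum_congr rfl fun p' _ => ?_
        rw [Finset.prod_mul_distrib, hflag]
        simp only [tensorMatrix, tensor, Matrix.of_apply, φ]
        ring

/-- Gauge invariance. -/
theorem Intertwiners.connFun_smul {j : SpinNetwork Γ} (i : j.Intertwiners) (g : V → SU2)
    (x : Γ.Connection) : i.connFun (g • x) = i.connFun x := by
  have h1 : j.rep (g • x) =
      (tensorMatrix fun e => SU2.spinRep (j.twoSpin e) (g (Γ.src e))) * j.rep x *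
      (tensorMatrix fun e => SU2.spinRep (j.twoSpin e) (g (Γ.tgt e))⁻¹) := by
    simp only [rep, tensorMatrix_mul, ← map_mul]
    rfl
  have h2 : (tensorMatrix fun e => SU2.spinRep (j.twoSpin e) (g (Γ.tgt e))⁻¹) *
      (tensorMatrix fun e => SU2.spinRep (j.twoSpin e) (g (Γ.tgt e))) = 1 := by
    simp only [tensorMatrix_mul, ← map_mul, inv_mul_cancel, map_one, tensorMatrix_one]
  have h3 : (tensorMatrix fun e => SU2.spinRep (j.twoSpin e) (g (Γ.src e))).transpose *
      (tensorMatrix fun e => SU2.invForm (j.twoSpin e)) *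
      (tensorMatrix fun e => SU2.spinRep (j.twoSpin e) (g (Γ.src e))) =
      tensorMatrix fun e => SU2.invForm (j.twoSpin e) := by
    simp only [tensorMatrix_mul, tensorMatrix_transpose]
    congr 1
    funext e
    exact SU2.symMatrix_invForm _ _ (g (Γ.src e)).2.2
  unfold connFun endo
  have h4 := i.tensor_invariant g
  rw [h1]
  generalize (tensorMatrix fun e => SU2.spinRep (j.twoSpin e) (g (Γ.tgt e))⁻¹) = A' at *
  generalize (tensorMatrix fun e => SU2.spinRep (j.twoSpin e) (g (Γ.tgt e))) = A at *
  generalize (tensorMatrix fun e => SU2.spinRep (j.twoSpin e) (g (Γ.src e))) = B at *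
  generalize (tensorMatrix fun e => SU2.invForm (j.twoSpin e)) = W at *
  calc (i.tensor * W * (B * j.rep x * A')).trace
      = (A * i.tensor * B.transpose * W * (B * j.rep x * A')).trace := by rw [h4]
    _ = (A' * (A * i.tensor * B.transpose * W * (B * j.rep x))).trace := by
        rw [Matrix.trace_mul_comm A']
        simp only [Matrix.mul_assoc]
    _ = ((A' * A) * i.tensor * (B.transpose * W * B) * j.rep x).trace := by
        simp only [Matrix.mul_assoc]
    _ = (i.tensor * W * j.rep x).trace := by rw [h2, h3, Matrix.one_mul]

/-- The function of a spin network on the unitary Schottky space. -/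
noncomputable def Intertwiners.schottkyFun {j : SpinNetwork Γ} (i : j.Intertwiners) :
    Γ.UnitarySchottky → ℂ :=
  Quotient.lift i.connFun fun x y h => by
    obtain ⟨g, rfl⟩ := h
    exact i.connFun_smul g y

end SpinNetwork

/-!
The matrix coefficients of the irreducible representations of `SU(2)` are linearly independent.
This is proved here without integration: if `φ (ρ_n g) = φ' (ρ_{n'} g)` for linear functionals `φ`,
`φ'` on matrices and `n' < n`, put `g = g₁ diag(z, z⁻¹) g₂` with `|z| = 1` and compare the
coefficients of `z ^ n`, the highest weight of `ρ_n`. On the left this is the value of `φ` at the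
rank one matrix `(ρ_n g₁ e_n) (e_nᵀ ρ_n g₂)`, on the right there is none. These rank one matrices
are products of an `n`-th power of a linear form and a row of monomials, which span all
matrices, so that `φ = 0` (`SU2.eq_zero_of_comp_spinRep`). The same argument with `φ' = 0` shows
that the matrices `ρ_n g` span the full matrix algebra (`SU2.span_range_spinRep`).

Now let `j` and `j'` have the same function `f` but differ at an edge `e`. With the connection fixed
on the other edges, `f` is at once a matrix coefficient of `j e` and of `j' e`, and so it vanishes.
As `f` is the restriction of the multilinear form `M ↦ Tr (B (⨂ e, M e))` to tuples of
representation matrices, which span, this form vanishes, and hence `B = 0`. But `B ≠ 0`: the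
half-edges are partitioned by the vertices, so a tensor product of nonzero intertwiners is nonzero,
and the invariant bilinear forms are nondegenerate (`SpinNetwork.Intertwiners.endo_ne_zero`).
-/

open Matrix

/-! ### Matrix coefficients of `SU(2)` -/

namespace SU2

/-- The element of `SU(2)` with first column `(a, c)`. -/
noncomputable def ofColumn (a c : ℂ) (h : ‖a‖ ^ 2 + ‖c‖ ^ 2 = 1) : SU2 :=
  ⟨!![a, -star c; c, star a], by
    have h' : a * star a + c * star c = 1 := by
      simp only [Complex.star_def, Complex.mul_conj']
      exact_mod_cast h
    rw [mem_specialUnitaryGroup_iff]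
    constructor
    · rw [mem_unitaryGroup_iff']
      ext i k
      fin_cases i <;> fin_cases k <;>
        simp only [mul_apply, Fin.sum_univ_two, star_apply, of_apply, cons_val', cons_val_zero,
          cons_val_one, cons_val_fin_one, Fin.zero_eta, Fin.mk_one, star_neg, star_star,
          one_apply_eq, one_apply_ne, ne_eq, zero_ne_one, one_ne_zero, not_false_eq_true] <;>
        first | linear_combination h' | ring
    · rw [det_fin_two_of]
      linear_combination h'⟩

theorem powVec_one_zero (n : ℕ) : powVec n 1 0 = Pi.single (Fin.last n) 1 := by
  ext k
  rcases eq_or_ne k (Fin.last n) with rfl | hk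
  · simp [powVec]
  · have : n - (k : ℕ) ≠ 0 := by
      have := Fin.lt_last_iff_ne_last.mpr hk
      rw [Fin.lt_def, Fin.val_last] at this
      omega
    simp [powVec, hk, this]

theorem monoms_one_zero (n : ℕ) : monoms n 1 0 = Pi.single (Fin.last n) 1 := by
  ext k
  rcases eq_or_ne k (Fin.last n) with rfl | hk
  · simp [monoms]
  · have : n - (k : ℕ) ≠ 0 := by
      have := Fin.lt_last_iff_ne_last.mpr hk
      rw [Fin.lt_def, Fin.val_last] at this
      omega
    simp [monoms, hk, this]

theorem powVec_smul (n : ℕ) (r x y : ℂ) : powVec n (r * x) (r * y) = r ^ n • powVec n x y := by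
  ext k
  have : r ^ n = r ^ (k : ℕ) * r ^ (n - (k : ℕ)) := by rw [← pow_add]; congr 1; omega
  simp only [powVec, Pi.smul_apply, smul_eq_mul, this, mul_pow]
  ring

theorem monoms_smul (n : ℕ) (r x y : ℂ) : monoms n (r * x) (r * y) = r ^ n • monoms n x y := by
  ext k
  have : r ^ n = r ^ (k : ℕ) * r ^ (n - (k : ℕ)) := by rw [← pow_add]; congr 1; omega
  simp only [monoms, Pi.smul_apply, smul_eq_mul, this, mul_pow]
  ring

theorem symMatrix_diagonal (n : ℕ) (z w : ℂ) :
    symMatrix n !![z, 0; 0, w] = diagonal fun k : Fin (n + 1) => z ^ (k : ℕ) * w ^ (n - (k : ℕ)) := by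
  ext k l
  have : (Polynomial.C z * Polynomial.X) ^ (l : ℕ) * (Polynomial.C w) ^ (n - (l : ℕ)) =
      Polynomial.C (z ^ (l : ℕ) * w ^ (n - (l : ℕ))) * Polynomial.X ^ (l : ℕ) := by
    simp only [mul_pow, map_mul, map_pow]
    ring
  simp only [symMatrix, of_apply, cons_val', cons_val_zero, cons_val_one, cons_val_fin_one,
    map_zero, add_zero, zero_mul, zero_add, this, Polynomial.coeff_C_mul_X_pow, diagonal_apply,
    Fin.val_inj]
  split_ifs with h
  · rw [h]
  · rfl

/-- Every vector of `ℂ²`, zero included, is a multiple of a unit vector. -/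
theorem exists_smul_unit (x y : ℂ) :
    ∃ r a c : ℂ, ‖a‖ ^ 2 + ‖c‖ ^ 2 = 1 ∧ x = r * a ∧ y = r * c := by
  by_cases h : x = 0 ∧ y = 0
  · exact ⟨0, 1, 0, by simp, by simp [h.1], by simp [h.2]⟩
  · have hpos : 0 < ‖x‖ ^ 2 + ‖y‖ ^ 2 := by
      by_cases hx : x = 0
      · have : 0 < ‖y‖ := norm_pos_iff.mpr fun hy => h ⟨hx, hy⟩
        positivity
      · have : 0 < ‖x‖ := norm_pos_iff.mpr hx
        positivity
    have hs : 0 < √(‖x‖ ^ 2 + ‖y‖ ^ 2) := Real.sqrt_pos.mpr hpos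
    have hs' : ((√(‖x‖ ^ 2 + ‖y‖ ^ 2) : ℝ) : ℂ) ≠ 0 := by exact_mod_cast hs.ne'
    refine ⟨(√(‖x‖ ^ 2 + ‖y‖ ^ 2) : ℝ), x / (√(‖x‖ ^ 2 + ‖y‖ ^ 2) : ℝ),
      y / (√(‖x‖ ^ 2 + ‖y‖ ^ 2) : ℝ), ?_, by field_simp, by field_simp⟩
    rw [norm_div, norm_div, Complex.norm_real, Real.norm_of_nonneg hs.le, div_pow, div_pow,
      Real.sq_sqrt hpos.le, ← add_div, div_self hpos.ne']

/-- The rank one matrices `(ρ_n g₁ e_n) (e_nᵀ ρ_n g₂)`, where `e_n` is the highest weight vector and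
`g₁`, `g₂` range over `SU(2)`, span all matrices. -/
theorem eq_zero_of_vecMulVec {n : ℕ}
    (φ : Matrix (Fin (n + 1)) (Fin (n + 1)) ℂ →ₗ[ℂ] ℂ)
    (h : ∀ a c a' b' : ℂ, ‖a‖ ^ 2 + ‖c‖ ^ 2 = 1 → ‖a'‖ ^ 2 + ‖b'‖ ^ 2 = 1 →
      φ (vecMulVec (powVec n a c) (monoms n a' b')) = 0) : φ = 0 := by
  have hall : ∀ x y x' y' : ℂ, φ (vecMulVec (powVec n x y) (monoms n x' y')) = 0 := by
    intro x y x' y'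
    obtain ⟨r, a, c, hac, rfl, rfl⟩ := exists_smul_unit x y
    obtain ⟨r', a', b', hab, rfl, rfl⟩ := exists_smul_unit x' y'
    rw [powVec_smul, monoms_smul, smul_vecMulVec, vecMulVec_smul, map_smul, map_smul,
      h a c a' b' hac hab, smul_zero, smul_zero]
  have hexp : ∀ u v : Fin (n + 1) → ℂ,
      φ (vecMulVec u v) = u ⬝ᵥ fun k => v ⬝ᵥ fun l => φ (single k l 1) := by
    intro u v
    conv_lhs => rw [matrix_eq_sum_single (vecMulVec u v)]
    simp only [map_sum, dotProduct, Finset.mul_sum]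
    refine Finset.sum_congr rfl fun k _ => Finset.sum_congr rfl fun l _ => ?_
    rw [← mul_one (vecMulVec u v k l), ← smul_eq_mul, ← smul_single, map_smul, vecMulVec_apply,
      smul_eq_mul, mul_assoc]
  have h1 : ∀ x' y', (fun k => monoms n x' y' ⬝ᵥ fun l => φ (single k l 1)) = 0 := by
    intro x' y'
    refine powVec_separate n fun x y => ?_
    rw [← hexp, hall, dotProduct_zero]
  have h2 : ∀ k, (fun l => φ (single k l 1)) = 0 := by
    intro k
    refine monoms_separate n fun x' y' => ?_
    rw [dotProduct_zero]
    exact congrFun (h1 x' y') k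
  refine Matrix.ext_linearMap ℂ fun k l => LinearMap.ext_ring ?_
  simpa using congrFun (h2 k) l

/-- The restriction of a matrix coefficient of spin `n / 2` to a translate of the maximal torus, as
a polynomial in `z` after multiplication by `z ^ n`. -/
theorem pow_mul_apply_torus {n : ℕ} (φ : Matrix (Fin (n + 1)) (Fin (n + 1)) ℂ →ₗ[ℂ] ℂ)
    (A B : Matrix (Fin (n + 1)) (Fin (n + 1)) ℂ) {z : ℂ} (hz : z ≠ 0) :
    z ^ n * φ (A * symMatrix n !![z, 0; 0, z⁻¹] * B) =
      ∑ m : Fin (n + 1), φ (A * single m m 1 * B) * z ^ (2 * (m : ℕ)) := by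
  have h1 : (z ^ n) • symMatrix n !![z, 0; 0, z⁻¹] =
      ∑ m : Fin (n + 1), z ^ (2 * (m : ℕ)) • single m m (1 : ℂ) := by
    rw [symMatrix_diagonal, ← sum_single_eq_diagonal, Finset.smul_sum]
    refine Finset.sum_congr rfl fun m _ => ?_
    have : z ^ n = z ^ (m : ℕ) * z ^ (n - (m : ℕ)) := by rw [← pow_add]; congr 1; omega
    rw [smul_single, smul_single, this]
    congr 1
    simp only [smul_eq_mul, inv_pow, two_mul, pow_add]
    field_simp
  rw [← smul_eq_mul, ← map_smul, ← smul_mul_assoc, ← mul_smul_comm, h1, Finset.mul_sum,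
    Finset.sum_mul, map_sum]
  refine Finset.sum_congr rfl fun m _ => ?_
  rw [mul_smul_comm, smul_mul_assoc, map_smul, smul_eq_mul, mul_comm]

theorem infinite_norm_eq_one : {z : ℂ | ‖z‖ = 1}.Infinite := by
  have : Set.InjOn (fun t : ℝ => Complex.exp (t * Complex.I)) (Set.Ioo 0 1) := by
    intro s hs t ht hst
    have := congrArg Complex.arg hst
    simp only at this
    have hpi := Real.pi_gt_three
    rwa [Complex.arg_exp_mul_I, Complex.arg_exp_mul_I, (toIocMod_eq_self _).mpr,
      (toIocMod_eq_self _).mpr] at this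
    · exact ⟨by linarith [ht.1], by linarith [ht.2]⟩
    · exact ⟨by linarith [hs.1], by linarith [hs.2]⟩
  refine ((Set.Ioo_infinite (zero_lt_one' ℝ)).image this).mono ?_
  rintro _ ⟨t, -, rfl⟩
  exact Complex.norm_exp_ofReal_mul_I t

/-- If a matrix coefficient of spin `n / 2` is zero or a matrix coefficient of a smaller spin, then
it has no component of weight `n`, and this forces the functional `φ` to vanish. -/
theorem eq_zero_of_comp_spinRep {n n' : ℕ}
    (φ : Matrix (Fin (n + 1)) (Fin (n + 1)) ℂ →ₗ[ℂ] ℂ)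
    (φ' : Matrix (Fin (n' + 1)) (Fin (n' + 1)) ℂ →ₗ[ℂ] ℂ)
    (h : ∀ g, φ (spinRep n g) = φ' (spinRep n' g)) (hn : n' < n ∨ φ' = 0) : φ = 0 := by
  refine eq_zero_of_vecMulVec φ fun a c a' b' hac hab => ?_
  set g₁ := ofColumn a c hac with hg₁
  set g₂ := ofColumn a' (-star b') (by simpa using hab) with hg₂
  have htop : spinRep n g₁ * single (Fin.last n) (Fin.last n) 1 * spinRep n g₂ =
      vecMulVec (powVec n a c) (monoms n a' b') := by
    have e1 : (spinRep n g₁) *ᵥ Pi.single (Fin.last n) 1 = powVec n a c := by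
      rw [← powVec_one_zero]
      refine (symMatrix_mulVec_powVec n _ 1 0).trans ?_
      simp [hg₁, ofColumn]
    have e2 : Pi.single (Fin.last n) 1 ᵥ* (spinRep n g₂) = monoms n a' b' := by
      rw [← monoms_one_zero]
      refine (monoms_vecMul_symMatrix n _ 1 0).trans ?_
      simp [hg₂, ofColumn]
    rw [← e1, ← e2, ← mul_vecMulVec, ← vecMulVec_mul, single_eq_single_vecMulVec_single,
      Matrix.mul_assoc]
  -- Both sides, multiplied by `z ^ n`, as polynomials in `z`; `P` has the coefficient sought
  -- in degree `2 * n`, and `Q` has degree at most `n + n'`.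
  let P : Polynomial ℂ := ∑ m : Fin (n + 1), Polynomial.C
    (φ (spinRep n g₁ * single m m 1 * spinRep n g₂)) * Polynomial.X ^ (2 * (m : ℕ))
  let Q : Polynomial ℂ := ∑ m : Fin (n' + 1), Polynomial.C
    (φ' (spinRep n' g₁ * single m m 1 * spinRep n' g₂)) *
      Polynomial.X ^ (2 * (m : ℕ) + (n - n'))
  have hPQ : P = Q := by
    refine Polynomial.eq_of_infinite_eval_eq P Q (infinite_norm_eq_one.mono ?_)
    intro z hz
    have hz1 : ‖z‖ = 1 := hz
    have hz0 : z ≠ 0 := norm_ne_zero_iff.mp (by rw [hz1]; exact one_ne_zero)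
    have ht : ((ofColumn z 0 (by simp [hz1]) : SU2) : Matrix (Fin 2) (Fin 2) ℂ) =
        !![z, 0; 0, z⁻¹] := by
      simp [ofColumn, Complex.inv_eq_conj hz1]
    have hg := h (g₁ * ofColumn z 0 (by simp [hz1]) * g₂)
    simp only [map_mul] at hg
    have hrep : ∀ m, spinRep m (ofColumn z 0 (by simp [hz1])) = symMatrix m !![z, 0; 0, z⁻¹] :=
      fun m => congrArg (symMatrix m) ht
    rw [hrep, hrep] at hg
    have hP : P.eval z = z ^ n * φ (spinRep n g₁ * symMatrix n !![z, 0; 0, z⁻¹] * spinRep n g₂) := by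
      rw [pow_mul_apply_torus φ _ _ hz0]
      simp [P, Polynomial.eval_finsetSum]
    change P.eval z = Q.eval z
    rw [hP, hg]
    rcases hn with hn | rfl
    · have : z ^ n = z ^ (n - n') * z ^ n' := by rw [← pow_add]; congr 1; omega
      rw [this, mul_assoc, pow_mul_apply_torus φ' _ _ hz0, Finset.mul_sum]
      simp only [Q, Polynomial.eval_finsetSum, Polynomial.eval_mul, Polynomial.eval_C,
        Polynomial.eval_pow, Polynomial.eval_X, pow_add]
      exact Finset.sum_congr rfl fun m _ => by ring
    · simp [Q]
  have hcP : P.coeff (2 * n) = φ (vecMulVec (powVec n a c) (monoms n a' b')) := by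
    simp only [P, Polynomial.finsetSum_coeff, Polynomial.coeff_C_mul_X_pow]
    rw [Finset.sum_eq_single (Fin.last n), if_pos (by simp), htop]
    · intro m _ hm
      refine if_neg fun h => hm (Fin.ext ?_)
      rw [Fin.val_last]
      omega
    · simp
  have hcQ : Q.coeff (2 * n) = 0 := by
    rcases hn with hn | rfl
    · simp only [Q, Polynomial.finsetSum_coeff, Polynomial.coeff_C_mul_X_pow]
      exact Finset.sum_eq_zero fun m _ => if_neg (by omega)
    · simp [Q]
  rw [← hcP, hPQ, hcQ]

/-- A function on `SU(2)` that is a matrix coefficient of two different spins is zero. -/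
theorem apply_spinRep_eq_zero {n n' : ℕ} (hn : n ≠ n')
    (φ : Matrix (Fin (n + 1)) (Fin (n + 1)) ℂ →ₗ[ℂ] ℂ)
    (φ' : Matrix (Fin (n' + 1)) (Fin (n' + 1)) ℂ →ₗ[ℂ] ℂ)
    (h : ∀ g, φ (spinRep n g) = φ' (spinRep n' g)) (g : SU2) : φ (spinRep n g) = 0 := by
  rcases lt_or_gt_of_ne hn with hlt | hlt
  · rw [h, eq_zero_of_comp_spinRep φ' φ (fun g => (h g).symm) (Or.inl hlt), LinearMap.zero_apply]
  · rw [eq_zero_of_comp_spinRep φ φ' h (Or.inl hlt), LinearMap.zero_apply]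

theorem span_range_spinRep (n : ℕ) : Submodule.span ℂ (Set.range (spinRep n)) = ⊤ := by
  by_contra hne
  obtain ⟨φ, hφ, hle⟩ := Submodule.exists_le_ker_of_lt_top _ (lt_top_iff_ne_top.mpr hne)
  refine hφ (eq_zero_of_comp_spinRep φ (0 : Matrix (Fin (n + 1)) (Fin (n + 1)) ℂ →ₗ[ℂ] ℂ)
    (fun g => ?_) (Or.inr rfl))
  exact hle (Submodule.subset_span (Set.mem_range_self g))

theorem invForm_rev (n : ℕ) (k : Fin (n + 1)) : invForm n k.rev k ≠ 0 := by
  have hk : (k.rev : ℕ) ≤ n := Nat.lt_succ_iff.mp k.rev.2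
  have hs : (k.rev : ℕ) + (k : ℕ) = n := by rw [Fin.val_rev]; omega
  simp only [invForm, of_apply, if_pos hs]
  have : (n.choose (k.rev : ℕ) : ℂ) ≠ 0 := by exact_mod_cast (Nat.choose_pos hk).ne'
  exact div_ne_zero (pow_ne_zero _ (by norm_num)) this

theorem invForm_eq_zero (n : ℕ) {k l : Fin (n + 1)} (h : k ≠ l.rev) : invForm n k l = 0 := by
  simp only [invForm, of_apply]
  refine if_neg fun hs => h (Fin.ext ?_)
  rw [Fin.val_rev]
  omega

end SU2

/-! ### Multilinear forms on tuples of matrices -/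

/-- A multilinear form is determined by its values at tuples from spanning families. -/
theorem MultilinearMap.eq_zero_of_span_eq_top {ι : Type*} [Finite ι] {K : Type*} [Field K]
    {M : ι → Type*} [∀ i, AddCommGroup (M i)] [∀ i, Module K (M i)] {α : ι → Type*}
    {s : ∀ i, α i → M i} (hs : ∀ i, Submodule.span K (Set.range (s i)) = ⊤)
    (T : MultilinearMap K M K) (hT : ∀ x : ∀ i, α i, (T fun i => s i (x i)) = 0) : T = 0 := by
  refine Module.Basis.ext_multilinear (fun i => Module.Basis.ofSpan (hs i).ge) fun v => ?_
  have hmem : ∀ i, ∃ a, s i a = Module.Basis.ofSpan (hs i).ge (v i) := fun i =>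
    Module.Basis.ofSpan_subset (hs i).ge (Set.mem_range_self (v i))
  choose x hx using hmem
  simp only [← hx, hT, _root_.zero_apply]

/-- The multilinear form `M ↦ Tr (B (⨂ i, M i))`. -/
noncomputable def traceForm {ι : Type*} [Fintype ι] [DecidableEq ι] {n : ι → ℕ}
    (B : Matrix (∀ i, Fin (n i + 1)) (∀ i, Fin (n i + 1)) ℂ) :
    MultilinearMap ℂ (fun i => Matrix (Fin (n i + 1)) (Fin (n i + 1)) ℂ) ℂ :=
  ∑ p, ∑ q, B p q • (MultilinearMap.mkPiAlgebra ℂ ι ℂ).compLinearMap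
    fun i => entryLinearMap ℂ ℂ (q i) (p i)

theorem traceForm_apply {ι : Type*} [Fintype ι] [DecidableEq ι] {n : ι → ℕ}
    (B : Matrix (∀ i, Fin (n i + 1)) (∀ i, Fin (n i + 1)) ℂ)
    (M : ∀ i, Matrix (Fin (n i + 1)) (Fin (n i + 1)) ℂ) :
    traceForm B M = (B * tensorMatrix M).trace := by
  simp [traceForm, trace, mul_apply, tensorMatrix]

theorem eq_zero_of_traceForm_eq_zero {ι : Type*} [Fintype ι] [DecidableEq ι] {n : ι → ℕ}
    {B : Matrix (∀ i, Fin (n i + 1)) (∀ i, Fin (n i + 1)) ℂ} (h : traceForm B = 0) : B = 0 := by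
  ext p q
  have hs : tensorMatrix (fun i => single (q i) (p i) (1 : ℂ)) = single q p 1 := by
    ext q' p'
    simp only [tensorMatrix, of_apply, single_apply]
    rw [Finset.prod_ite_zero]
    simp [funext_iff, forall_and]
  have h1 := traceForm_apply B fun i => single (q i) (p i) 1
  rw [h, hs, trace_mul_single] at h1
  simpa using h1.symm

/-! ### The function of a spin network -/

namespace SpinNetwork

variable {V E : Type*} [Fintype V] [DecidableEq V] [Fintype E] [DecidableEq E]
  {Γ : TrivalentGraph V E}

theorem Intertwiners.tensor_ne_zero {j : SpinNetwork Γ} (i : j.Intertwiners) :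
    i.tensor ≠ 0 := by
  have hr : ∀ v, ∃ r, i.vec v r ≠ 0 := fun v => Function.ne_iff.mp (i.ne_zero v)
  choose r hr using hr
  intro h0
  have h1 := congrFun (congrFun h0 fun e => r (Γ.tgt e) ⟨(e, true), rfl⟩)
    fun e => r (Γ.src e) ⟨(e, false), rfl⟩
  simp only [tensor, of_apply, Matrix.zero_apply] at h1
  obtain ⟨v, -, hv⟩ := Finset.prod_eq_zero_iff.mp h1
  refine hr v ?_
  convert hv using 2
  funext h
  obtain ⟨⟨e, b⟩, rfl⟩ := h
  cases b <;> rfl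

theorem Intertwiners.endo_ne_zero {j : SpinNetwork Γ} (i : j.Intertwiners) : i.endo ≠ 0 := by
  intro h0
  refine i.tensor_ne_zero ?_
  ext p q
  -- The invariant forms are antidiagonal, so only one summand of the product survives.
  have h1 := congrFun (congrFun h0 p) fun e => (q e).rev
  rw [endo, mul_apply, Finset.sum_eq_single q] at h1
  · refine (mul_eq_zero.mp h1).resolve_right (Finset.prod_ne_zero_iff.mpr fun e _ => ?_)
    simpa using SU2.invForm_rev (j.twoSpin e) (q e).rev
  · intro r _ hr
    obtain ⟨e, he⟩ := Function.ne_iff.mp hr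
    refine mul_eq_zero_of_right _ (Finset.prod_eq_zero (Finset.mem_univ e) ?_)
    exact SU2.invForm_eq_zero _ (by rwa [Fin.rev_rev])
  · simp

theorem Intertwiners.connFun_eq_traceForm {j : SpinNetwork Γ} (i : j.Intertwiners)
    (x : Γ.Connection) :
    i.connFun x = traceForm i.endo fun e => SU2.spinRep (j.twoSpin e) (x e) :=
  (traceForm_apply _ _).symm

theorem Intertwiners.exists_connFun_ne_zero {j : SpinNetwork Γ} (i : j.Intertwiners) :
    ∃ x, i.connFun x ≠ 0 := by
  by_contra! h
  refine i.endo_ne_zero (eq_zero_of_traceForm_eq_zero ?_)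
  refine MultilinearMap.eq_zero_of_span_eq_top
    (fun e => SU2.span_range_spinRep (j.twoSpin e)) _ fun x => ?_
  exact (i.connFun_eq_traceForm x).symm.trans (h x)

/-- As a function of the holonomy along the edge `e`, the function of a spin network is a
matrix coefficient of the representation at `e`. -/
theorem Intertwiners.connFun_update {j : SpinNetwork Γ} (i : j.Intertwiners)
    (x : E → SU2) (e : E) (g : SU2) :
    i.connFun (Function.update x e g) =
      (traceForm i.endo).toLinearMap (fun e => SU2.spinRep (j.twoSpin e) (x e)) e
        (SU2.spinRep (j.twoSpin e) g) := by
  refine (i.connFun_eq_traceForm _).trans ?_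
  rw [MultilinearMap.toLinearMap_apply]
  congr 1
  funext e'
  rcases eq_or_ne e' e with rfl | he
  · simp
  · simp [he]

end SpinNetwork

theorem proposition24 {V E : Type*} [Fintype V] [DecidableEq V] [Fintype E] [DecidableEq E]
    (Γ : TrivalentGraph V E) (j j' : SpinNetwork Γ) (i : j.Intertwiners) (i' : j'.Intertwiners)
    (h : i.schottkyFun = i'.schottkyFun) : j = j' := by
  have hf : ∀ x, i.connFun x = i'.connFun x := fun x => congrFun h (Quotient.mk _ x)
  have hspin : j.twoSpin = j'.twoSpin := by
    funext e
    by_contra hne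
    obtain ⟨x, hx⟩ := i.exists_connFun_ne_zero
    refine hx ?_
    have hx' := (i.connFun_update x e (x e)).trans <|
      SU2.apply_spinRep_eq_zero hne _
        ((traceForm i'.endo).toLinearMap (fun e => SU2.spinRep (j'.twoSpin e) (x e)) e)
        (fun g => (i.connFun_update x e g).symm.trans ((hf _).trans (i'.connFun_update x e g)))
        (x e)
    exact (congrArg i.connFun (Function.update_eq_self e x)).symm.trans hx'
  cases j
  cases j'
  cases hspin
  rfl
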